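/- Let $M$ be a smooth (Hausdorff) manifold of dimension $4n+3$, $n\ge 0$, with an almost contact HN-metric 3-structure $(\varphi_\alpha,\xi_\alpha,\eta_\alpha,g)$, $\alpha\in\{1,2,3\}$. That is, $\varphi_\alpha$ are smooth endomorphism fields of the tangent bundle, $\xi_\alpha$ smooth vector fields and $\eta_\alpha$ smooth 1-forms with $$\varphi_\alpha\circ\varphi_\beta=-\delta_{\alpha\beta}I+\xi_\alpha\otimes\eta_\beta+\sum_{\gamma}\epsilon_{\alpha\beta\gamma}\varphi_\gamma,\qquad \varphi_\alpha\xi_\beta=\sum_\gamma\epsilon_{\alpha\beta\gamma}\xi_\gamma,\qquad \eta_\alpha\circ\varphi_\beta=\sum_\gamma\epsilon_{\alpha\beta\gamma}\eta_\gamma,\qquad \eta_\alpha(\xi_\beta)=\delta_{\alpha\beta}$$ for all $\alpha,\beta\in\{1,2,3\}$, where $\delta_{\alpha\beta}$ is the Kronecker delta, $\epsilon_{\alpha\beta\gamma}$ is the Levi-Civita symbol and $(\xi_\alpha\otimes\eta_\beta)(x)=\eta_\beta(x)\xi_\alpha$; and $g$ is a pseudo-Riemannian metric with $$g(\varphi_\alpha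 x,\varphi_\alpha y)=\varepsilon_\alpha\, g(x,y)+\eta_\alpha(x)\eta_\alpha(y),\qquad \alpha=1,2,3,\qquad (\varepsilon_1,\varepsilon_2,\varepsilon_3)=(1,-1,-1).$$ For smooth vector fields $x,y$ let $\{x,y\}=\nabla_xy+\nabla_yx$, where $\nabla$ is the Levi-Civita connection of $g$; equivalently, for all smooth vector fields $z$, $$g(\{x,y\},z)=x\,g(y,z)+y\,g(x,z)-z\,g(x,y)-g([y,z],x)+g([z,x],y).$$ Define the associated Nijenhuis tensors $\widehat N_1,\widehat N_2,\widehat N_3$ by $$\widehat N_\alpha(x,y)=\{\varphi_\alpha x,\varphi_\alpha y\}+\varphi_\alpha^2\{x,y\}-\varphi_\alpha\{\varphi_\alpha x,y\}-\varphi_\alpha\{x,\varphi_\alpha y\}-\varepsilon_\alpha\,(\mathfrak L_{\xi_\alpha}g)(x,y)\,\xi_\alpha ,$$ where $\mathfrak L_{\xi_\alpha}g$ is the Lie derivative of $g$ along $\xi_\alpha$. If two of the three tensors $\widehat N_1,\widehat N_2,\widehat N_3$ vanish identically on $M$, then the third one also vanishes identically on $M$. -/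

import Mathlib

open scoped Manifold ContDiff

noncomputable section

namespace HNContact

section Metric

variable {E : Type*} [NormedAddCommGroup E] [NormedSpace ℝ E]
  {M : Type*} [TopologicalSpace M] [ChartedSpace E M] [IsManifold 𝓘(ℝ, E) ∞ M]

/-- A smooth vector field on `M`. -/
def SmoothField (X : Π p : M, TangentSpace 𝓘(ℝ, E) p) : Prop :=
  ContMDiff 𝓘(ℝ, E) 𝓘(ℝ, E).tangent ∞
    (fun p ↦ (⟨p, X p⟩ : TangentBundle 𝓘(ℝ, E) M))

/-- A vector field that is differentiable at the point `p`. -/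
def DiffFieldAt (X : Π p : M, TangentSpace 𝓘(ℝ, E) p) (p : M) : Prop :=
  MDifferentiableAt 𝓘(ℝ, E) 𝓘(ℝ, E).tangent
    (fun q ↦ (⟨q, X q⟩ : TangentBundle 𝓘(ℝ, E) M)) p

/-- The derivative `x(f)` of a function `f` along a vector field `x`. -/
def dirDeriv (X : Π p : M, TangentSpace 𝓘(ℝ, E) p) (f : M → ℝ) (p : M) : ℝ :=
  mvfderiv 𝓘(ℝ, E) f p (X p)

variable (E M) in
/-- A pseudo-Riemannian metric on `M`: a smooth field of symmetric, nondegenerate bilinear forms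
on the tangent spaces. -/
structure PseudoRiemannianMetric where
  /-- the bilinear form on each tangent space -/
  form (p : M) :
    TangentSpace 𝓘(ℝ, E) p →L[ℝ] TangentSpace 𝓘(ℝ, E) p →L[ℝ] ℝ
  symm (p : M) (v w : TangentSpace 𝓘(ℝ, E) p) : form p v w = form p w v
  nondegenerate (p : M) (v : TangentSpace 𝓘(ℝ, E) p) : (∀ w, form p v w = 0) → v = 0
  contMDiff : ContMDiff 𝓘(ℝ, E) (𝓘(ℝ, E).prod 𝓘(ℝ, E →L[ℝ] E →L[ℝ] ℝ)) ∞
    (fun p ↦ Bundle.TotalSpace.mk' (E →L[ℝ] E →L[ℝ] ℝ)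
      (E := fun p : M ↦ TangentSpace 𝓘(ℝ, E) p →L[ℝ] TangentSpace 𝓘(ℝ, E) p →L[ℝ] ℝ) p (form p))

namespace PseudoRiemannianMetric

variable (g : PseudoRiemannianMetric E M)

/-- The function `g(x, y)` for vector fields `x`, `y`. -/
def pair (X Y : Π p : M, TangentSpace 𝓘(ℝ, E) p) (p : M) : ℝ := g.form p (X p) (Y p)

/-- The Lie derivative of the metric,
`(𝔏_ξ g)(x, y) = ξ g(x, y) - g([ξ, x], y) - g(x, [ξ, y])`. -/
def lieDeriv (ξ X Y : Π p : M, TangentSpace 𝓘(ℝ, E) p) (p : M) : ℝ :=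
  dirDeriv ξ (g.pair X Y) p
    - g.pair (VectorField.mlieBracket 𝓘(ℝ, E) ξ X) Y p
    - g.pair X (VectorField.mlieBracket 𝓘(ℝ, E) ξ Y) p

/-- The symmetrized Koszul expression
`x g(y, z) + y g(x, z) - z g(x, y) - g([y, z], x) + g([z, x], y)`, which equals
`g(∇_x y + ∇_y x, z)` for the Levi-Civita connection `∇` of `g`. -/
def symKoszul (X Y Z : Π p : M, TangentSpace 𝓘(ℝ, E) p) (p : M) : ℝ :=
  dirDeriv X (g.pair Y Z) p + dirDeriv Y (g.pair X Z) p - dirDeriv Z (g.pair X Y) p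
    - g.pair (VectorField.mlieBracket 𝓘(ℝ, E) Y Z) X p
    + g.pair (VectorField.mlieBracket 𝓘(ℝ, E) Z X) Y p

open Classical in
/-- The symmetric braces `{x, y} = ∇_x y + ∇_y x` of two vector fields: the vector field determined
by `g({x, y}, z) = symKoszul x y z` for all `z`. Existence and uniqueness of the value at `p`, for
`x` and `y` differentiable at `p`, are `form_braces` and `eq_braces` below, so that the default
value `0` is not used for such fields. -/
def braces (X Y : Π p : M, TangentSpace 𝓘(ℝ, E) p) (p : M) : TangentSpace 𝓘(ℝ, E) p :=
  if h : ∃ v : TangentSpace 𝓘(ℝ, E) p, ∀ Z : Π q : M, TangentSpace 𝓘(ℝ, E) q,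
      DiffFieldAt Z p → g.form p v (Z p) = g.symKoszul X Y Z p
  then h.choose else 0

section Lemmas

variable {g} {X Y Z : Π p : M, TangentSpace 𝓘(ℝ, E) p} {p : M}

lemma mdifferentiableAt_pair (hX : DiffFieldAt X p) (hY : DiffFieldAt Y p) :
    MDifferentiableAt 𝓘(ℝ, E) 𝓘(ℝ) (g.pair X Y) p := by
  have : MDifferentiableAt 𝓘(ℝ, E) (𝓘(ℝ, E).prod 𝓘(ℝ))
      (fun m ↦ Bundle.TotalSpace.mk' ℝ (E := Bundle.Trivial M ℝ) m (g.form m (X m) (Y m))) p := by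
    apply MDifferentiableAt.clm_bundle_apply₂ (F₁ := E) (F₂ := E)
    · exact g.contMDiff.mdifferentiableAt (by simp)
    · exact hX
    · exact hY
  simp only [mdifferentiableAt_totalSpace] at this
  exact this.2

lemma tensorialAt_symKoszul [FiniteDimensional ℝ E] (hX : DiffFieldAt X p)
    (hY : DiffFieldAt Y p) :
    TensorialAt 𝓘(ℝ, E) E (fun Z ↦ g.symKoszul X Y Z p) p := by
  have : CompleteSpace E := FiniteDimensional.complete ℝ E
  constructor
  · intro f Z hf hZ
    have h1 : g.pair Y (f • Z) = f * g.pair Y Z := by ext q; simp [pair]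
    have h2 : g.pair X (f • Z) = f * g.pair X Z := by ext q; simp [pair]
    have h3 := VectorField.mlieBracket_smul_right (I := 𝓘(ℝ, E)) (V := Y) hf hZ
    have h4 := VectorField.mlieBracket_smul_left (I := 𝓘(ℝ, E)) (W := X) hf hZ
    simp only [symKoszul, dirDeriv, h1, h2, mvfderiv_mul hf (mdifferentiableAt_pair hY hZ),
      mvfderiv_mul hf (mdifferentiableAt_pair hX hZ)]
    simp only [pair, h3, h4, Pi.smul_apply', map_add, map_smul, map_neg, neg_smul,
      add_apply, smul_apply, neg_apply,
      smul_eq_mul, g.symm p (Z p)]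
    ring
  · intro Z W hZ hW
    have h1 : g.pair Y (Z + W) = g.pair Y Z + g.pair Y W := by ext q; simp [pair]
    have h2 : g.pair X (Z + W) = g.pair X Z + g.pair X W := by ext q; simp [pair]
    have h3 := VectorField.mlieBracket_add_right (I := 𝓘(ℝ, E)) (V := Y) hZ hW
    have h4 := VectorField.mlieBracket_add_left (I := 𝓘(ℝ, E)) (W := X) hZ hW
    simp only [symKoszul, dirDeriv, h1, h2,
      mvfderiv_add (mdifferentiableAt_pair hY hZ) (mdifferentiableAt_pair hY hW),
      mvfderiv_add (mdifferentiableAt_pair hX hZ) (mdifferentiableAt_pair hX hW)]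
    simp only [pair, h3, h4, Pi.add_apply, map_add, add_apply]
    ring

lemma exists_braces [FiniteDimensional ℝ E] (hX : DiffFieldAt X p) (hY : DiffFieldAt Y p) :
    ∃ v : TangentSpace 𝓘(ℝ, E) p, ∀ Z : Π q : M, TangentSpace 𝓘(ℝ, E) q,
      DiffFieldAt Z p → g.form p v (Z p) = g.symKoszul X Y Z p := by
  have : FiniteDimensional ℝ (TangentSpace 𝓘(ℝ, E) p) := inferInstanceAs (FiniteDimensional ℝ E)
  let T := TensorialAt.mkHom (fun Z ↦ g.symKoszul X Y Z p) p (tensorialAt_symKoszul hX hY)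
  let L : TangentSpace 𝓘(ℝ, E) p →ₗ[ℝ] Module.Dual ℝ (TangentSpace 𝓘(ℝ, E) p) :=
    { toFun v := (g.form p v).toLinearMap
      map_add' v w := by ext u; simp
      map_smul' c v := by ext u; simp }
  have hL : Function.Injective L := by
    rw [injective_iff_map_eq_zero]
    intro v hv
    exact g.nondegenerate p v fun w ↦ LinearMap.congr_fun hv w
  obtain ⟨v, hv⟩ := (LinearMap.injective_iff_surjective_of_finrank_eq_finrank
    Subspace.dual_finrank_eq.symm).1 hL T.toLinearMap
  refine ⟨v, fun Z hZ ↦ ?_⟩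
  have h1 : g.form p v (Z p) = T (Z p) := LinearMap.congr_fun hv (Z p)
  rw [h1]
  exact TensorialAt.mkHom_apply (tensorialAt_symKoszul hX hY) hZ

/-- The defining property of the braces. -/
lemma form_braces [FiniteDimensional ℝ E] (hX : DiffFieldAt X p) (hY : DiffFieldAt Y p)
    (hZ : DiffFieldAt Z p) : g.form p (g.braces X Y p) (Z p) = g.symKoszul X Y Z p := by
  have h := exists_braces (g := g) hX hY
  rw [braces, dif_pos h]
  exact h.choose_spec Z hZ

/-- The defining property determines the braces. -/
lemma eq_braces [FiniteDimensional ℝ E] (hX : DiffFieldAt X p) (hY : DiffFieldAt Y p)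
    (v : TangentSpace 𝓘(ℝ, E) p)
    (hv : ∀ Z : Π q : M, TangentSpace 𝓘(ℝ, E) q, DiffFieldAt Z p →
      g.form p v (Z p) = g.symKoszul X Y Z p) : v = g.braces X Y p := by
  refine sub_eq_zero.1 (g.nondegenerate p _ fun w ↦ ?_)
  have hw : DiffFieldAt (FiberBundle.extend E w) p := FiberBundle.mdifferentiableAt_extend ..
  have h1 := hv _ hw
  rw [← form_braces hX hY hw] at h1
  simpa [sub_eq_zero] using h1

end Lemmas

end PseudoRiemannianMetric

end Metric

section Structure

/-- The Levi-Civita symbol, with the index values `1, 2, 3` written as `0, 1, 2`. -/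
def leviCivita : Fin 3 → Fin 3 → Fin 3 → ℝ
  | 0, 1, 2 => 1
  | 1, 2, 0 => 1
  | 2, 0, 1 => 1
  | 0, 2, 1 => -1
  | 2, 1, 0 => -1
  | 1, 0, 2 => -1
  | _, _, _ => 0

/-- The signs `(ε₁, ε₂, ε₃) = (1, -1, -1)`. -/
def hnSign : Fin 3 → ℝ := ![1, -1, -1]

variable (E : Type*) [NormedAddCommGroup E] [NormedSpace ℝ E]
  (M : Type*) [TopologicalSpace M] [ChartedSpace E M] [IsManifold 𝓘(ℝ, E) ∞ M]

/-- An almost contact 3-structure `(φ_α, ξ_α, η_α)`, `α = 1, 2, 3`, on `M`: smooth endomorphism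
fields, vector fields and 1-forms which satisfy the algebraic identities of such a structure. -/
structure AlmostContact3Structure where
  /-- the endomorphisms of the tangent bundle -/
  φ (α : Fin 3) (p : M) : TangentSpace 𝓘(ℝ, E) p →L[ℝ] TangentSpace 𝓘(ℝ, E) p
  /-- the Reeb vector fields -/
  ξ (α : Fin 3) (p : M) : TangentSpace 𝓘(ℝ, E) p
  /-- the contact 1-forms -/
  η (α : Fin 3) (p : M) : TangentSpace 𝓘(ℝ, E) p →L[ℝ] ℝ
  contMDiff_φ (α : Fin 3) : ContMDiff 𝓘(ℝ, E) (𝓘(ℝ, E).prod 𝓘(ℝ, E →L[ℝ] E)) ∞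
    (fun p ↦ Bundle.TotalSpace.mk' (E →L[ℝ] E)
      (E := fun p : M ↦ TangentSpace 𝓘(ℝ, E) p →L[ℝ] TangentSpace 𝓘(ℝ, E) p) p (φ α p))
  smooth_ξ (α : Fin 3) : SmoothField (ξ α)
  contMDiff_η (α : Fin 3) : ContMDiff 𝓘(ℝ, E) (𝓘(ℝ, E).prod 𝓘(ℝ, E →L[ℝ] ℝ)) ∞
    (fun p ↦ Bundle.TotalSpace.mk' (E →L[ℝ] ℝ)
      (E := fun p : M ↦ TangentSpace 𝓘(ℝ, E) p →L[ℝ] ℝ) p (η α p))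
  φ_φ (α β : Fin 3) (p : M) (v : TangentSpace 𝓘(ℝ, E) p) :
    φ α p (φ β p v) =
      -((if α = β then (1 : ℝ) else 0) • v) + η β p v • ξ α p
        + ∑ γ, leviCivita α β γ • φ γ p v
  φ_ξ (α β : Fin 3) (p : M) : φ α p (ξ β p) = ∑ γ, leviCivita α β γ • ξ γ p
  η_φ (α β : Fin 3) (p : M) (v : TangentSpace 𝓘(ℝ, E) p) :
    η α p (φ β p v) = ∑ γ, leviCivita α β γ * η γ p v
  η_ξ (α β : Fin 3) (p : M) : η α p (ξ β p) = if α = β then 1 else 0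

/-- An almost contact HN-metric 3-structure: an almost contact 3-structure with a
pseudo-Riemannian metric `g` such that
`g(φ_α x, φ_α y) = ε_α g(x, y) + η_α(x) η_α(y)` for `α = 1, 2, 3`. -/
structure AlmostContactHNMetric3Structure extends AlmostContact3Structure E M where
  /-- the HN-metric -/
  g : PseudoRiemannianMetric E M
  g_φ_φ (α : Fin 3) (p : M) (v w : TangentSpace 𝓘(ℝ, E) p) :
    g.form p (φ α p v) (φ α p w) = hnSign α * g.form p v w + η α p v * η α p w

namespace AlmostContactHNMetric3Structure

variable {E M} (S : AlmostContactHNMetric3Structure E M)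

/-- The vector field `φ_α x`. -/
def phi (α : Fin 3) (X : Π p : M, TangentSpace 𝓘(ℝ, E) p) (p : M) : TangentSpace 𝓘(ℝ, E) p :=
  S.φ α p (X p)

/-- `{φ_α, φ_α}(x, y) = {φ_α x, φ_α y} + φ_α²{x, y} - φ_α{φ_α x, y} - φ_α{x, φ_α y}`. -/
def phiBraces (α : Fin 3) (X Y : Π p : M, TangentSpace 𝓘(ℝ, E) p) :
    Π p : M, TangentSpace 𝓘(ℝ, E) p :=
  S.g.braces (S.phi α X) (S.phi α Y)
    + S.phi α (S.phi α (S.g.braces X Y))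
    - S.phi α (S.g.braces (S.phi α X) Y)
    - S.phi α (S.g.braces X (S.phi α Y))

/-- The associated Nijenhuis tensor
`N̂_α(x, y) = {φ_α, φ_α}(x, y) - ε_α (𝔏_{ξ_α} g)(x, y) ξ_α`, evaluated on vector fields. -/
def assocNijenhuis (α : Fin 3) (X Y : Π p : M, TangentSpace 𝓘(ℝ, E) p) (p : M) :
    TangentSpace 𝓘(ℝ, E) p :=
  S.phiBraces α X Y p - (hnSign α * S.g.lieDeriv (S.ξ α) X Y p) • S.ξ α p

/-- The tensor `N̂_α` vanishes: `N̂_α(x, y) = 0` for all smooth vector fields `x`, `y`. -/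
def AssocNijenhuisVanishes (α : Fin 3) : Prop :=
  ∀ X Y : Π p : M, TangentSpace 𝓘(ℝ, E) p, SmoothField X → SmoothField Y →
    ∀ p : M, S.assocNijenhuis α X Y p = 0

end AlmostContactHNMetric3Structure

end Structure

end HNContact

end

/-! The argument passes to `M × ℝ` with a product metric. There `J_α(x + f ∂/∂t) = φ_α x - f ξ_α +
η_α(x) ∂/∂t` defines three almost complex structures with the quaternionic relations, and the braces
of `t`-independent fields are `({x, y}, x(h) + y(f))`.

The concomitant of `J_α` with these braces vanishes exactly when `N̂_α` does. One direction is
immediate: its `M`-component at `f = h = 0` is `N̂_α(x, y)`. For the other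
(`nijenhuis_extJ_eq_zero`), setting `y = ξ_α`, or replacing `x` by `φ_α x`, in `N̂_α(x, y) = 0`
gives the remaining components, and the derivatives of `f` and `h` cancel. The signs `ε_α` disappear
because `g(x, ξ_α) = -ε_α η_α(x)`, so the three indices are treated alike.

What remains is quaternionic algebra (`nijenhuis_mul_eq_zero`): vanishing concomitants of `I` and
`J` force that of `IJ`, for any bilinear operation. Tensoriality is not needed, so the braces may
act on fields and be evaluated at one point. -/

noncomputable section

namespace HNContact

/-! ### Quaternionic algebra of concomitants. -/

section Quaternionic

variable {S A : Type*} [AddCommGroup S] [Module ℝ S] [AddCommGroup A] [Module ℝ A]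

/-- The Nijenhuis concomitant of a bilinear operation `B` from `S` to `A` with respect to an
endomorphism acting as `J` on `S` and as `j` on `A`, for `J² = -1`. -/
def nijenhuis (B : S →ₗ[ℝ] S →ₗ[ℝ] A) (J : S →ₗ[ℝ] S) (j : A →ₗ[ℝ] A) (x y : S) : A :=
  B (J x) (J y) - B x y - j (B (J x) y) - j (B x (J y))

/-- For anticommuting complex structures `I`, `J`, the vanishing of the Nijenhuis concomitants of
`I` and `J` implies that of `IJ`. -/
theorem nijenhuis_mul_eq_zero {B : S →ₗ[ℝ] S →ₗ[ℝ] A} {I J K : S →ₗ[ℝ] S} {i j k : A →ₗ[ℝ] A}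
    (hII : ∀ x, I (I x) = -x) (hJJ : ∀ x, J (J x) = -x)
    (hIJ : ∀ x, I (J x) = K x) (hJI : ∀ x, J (I x) = -K x)
    (hii : ∀ a, i (i a) = -a) (hjj : ∀ a, j (j a) = -a)
    (hij : ∀ a, i (j a) = k a) (hji : ∀ a, j (i a) = -k a)
    (hI : ∀ x y, nijenhuis B I i x y = 0) (hJ : ∀ x y, nijenhuis B J j x y = 0) (x y : S) :
    nijenhuis B K k x y = 0 := by
  have hIK (x) : I (K x) = -J x := by rw [← hIJ, hII]
  have hJK (x) : J (K x) = I x := by rw [← neg_neg (K x), ← hJI, map_neg, hJJ, neg_neg]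
  have hik (a) : i (k a) = -j a := by rw [← hij, hii]
  have hki (a) : k (i a) = j a := by rw [← hij, hji, map_neg, hik, neg_neg]
  have hkj (a) : k (j a) = -i a := by rw [← hij, hjj, map_neg]
  -- Every term expands to a multiple of `c (B (a x) (b y))` with `a`, `b`, `c` quaternion units.
  -- The eight instances are chosen so that, with the signs below, all terms cancel except twice the
  -- concomitant of `K`.
  have h1 := congrArg i (hI x (I y))
  have h2 := congrArg i (hJ (I x) y)
  have h3 := hJ (K x) (K y)
  have h4 := hI (J x) (J y)
  have h5 := hJ (J x) (J y)
  have h6 := congrArg k (hI x (K y))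
  have h7 := congrArg j (hI (K x) (I y))
  have h8 := congrArg k (hJ (J x) (I y))
  simp only [nijenhuis, hII, hJJ, hIJ, hJI, hIK, hJK, hii, hij, hji, hki, hkj, map_sub, map_neg,
    LinearMap.neg_apply, map_zero] at h1 h2 h3 h4 h5 h6 h7 h8 ⊢
  linear_combination (norm := module) (1 / 2 : ℝ) • (h1 - h2 - h3 + h4 - h5 + h6 + h7 - h8)

end Quaternionic

/-! ### Directional derivatives of functions. -/

section DirDeriv

variable {E : Type*} [NormedAddCommGroup E] [NormedSpace ℝ E]
  {M : Type*} [TopologicalSpace M] [ChartedSpace E M]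

lemma dirDeriv_zero (X : Π p : M, TangentSpace 𝓘(ℝ, E) p) (p : M) : dirDeriv X 0 p = 0 := by
  simp [dirDeriv, mvfderiv_zero]

lemma dirDeriv_const (c : ℝ) (X : Π p : M, TangentSpace 𝓘(ℝ, E) p) (p : M) :
    dirDeriv X (fun _ ↦ c) p = 0 := by
  simp [dirDeriv, mvfderiv_const]

lemma dirDeriv_const_smul (c : ℝ) (X : Π p : M, TangentSpace 𝓘(ℝ, E) p) {f : M → ℝ} {p : M}
    (hf : MDifferentiableAt 𝓘(ℝ, E) 𝓘(ℝ) f p) : dirDeriv X (c • f) p = c * dirDeriv X f p := by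
  rw [show c • f = (fun _ ↦ c) * f from rfl, dirDeriv, mvfderiv_mul mdifferentiableAt_const hf]
  simp [dirDeriv, mvfderiv_const]

lemma dirDeriv_sub_smul_left (X Y : Π p : M, TangentSpace 𝓘(ℝ, E) p) (h f : M → ℝ) (p : M) :
    dirDeriv (X - h • Y) f p = dirDeriv X f p - h p * dirDeriv Y f p := by
  simp [dirDeriv]

lemma dirDeriv_const_smul_left (c : ℝ) (X : Π p : M, TangentSpace 𝓘(ℝ, E) p) (f : M → ℝ) (p : M) :
    dirDeriv (c • X) f p = c * dirDeriv X f p := by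
  simp [dirDeriv]

end DirDeriv

/-! ### Calculus of the symmetric braces. -/

namespace PseudoRiemannianMetric

variable {E : Type*} [NormedAddCommGroup E] [NormedSpace ℝ E]
  {M : Type*} [TopologicalSpace M] [ChartedSpace E M] [IsManifold 𝓘(ℝ, E) ∞ M]
  {g : PseudoRiemannianMetric E M} {X X' Y Z : Π p : M, TangentSpace 𝓘(ℝ, E) p} {p : M}

lemma pair_comm (X Y : Π p : M, TangentSpace 𝓘(ℝ, E) p) : g.pair X Y = g.pair Y X :=
  funext fun p ↦ g.symm p (X p) (Y p)

lemma symKoszul_comm (X Y Z : Π p : M, TangentSpace 𝓘(ℝ, E) p) :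
    g.symKoszul X Y Z p = g.symKoszul Y X Z p := by
  have h : g.pair (VectorField.mlieBracket 𝓘(ℝ, E) Y Z) X p =
      -g.pair (VectorField.mlieBracket 𝓘(ℝ, E) Z Y) X p := by
    simp [pair, VectorField.mlieBracket_swap_apply (V := Y)]
  have h' : g.pair (VectorField.mlieBracket 𝓘(ℝ, E) X Z) Y p =
      -g.pair (VectorField.mlieBracket 𝓘(ℝ, E) Z X) Y p := by
    simp [pair, VectorField.mlieBracket_swap_apply (V := X)]
  simp only [symKoszul, h, h', pair_comm (g := g) X Y]
  ring

variable [FiniteDimensional ℝ E]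

lemma braces_comm (hX : DiffFieldAt X p) (hY : DiffFieldAt Y p) :
    g.braces X Y p = g.braces Y X p :=
  eq_braces hY hX _ fun Z hZ ↦ by rw [form_braces hX hY hZ, symKoszul_comm]

lemma braces_add_left (hX : DiffFieldAt X p) (hX' : DiffFieldAt X' p) (hY : DiffFieldAt Y p) :
    g.braces (X + X') Y p = g.braces X Y p + g.braces X' Y p := by
  have : CompleteSpace E := FiniteDimensional.complete ℝ E
  refine (eq_braces (mdifferentiableAt_add_section hX hX') hY _ fun Z hZ ↦ ?_).symm
  rw [map_add, add_apply, form_braces hX hY hZ, form_braces hX' hY hZ]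
  have h1 : g.pair (X + X') Z = g.pair X Z + g.pair X' Z := by ext q; simp [pair]
  have h2 : g.pair (X + X') Y = g.pair X Y + g.pair X' Y := by ext q; simp [pair]
  have h3 := VectorField.mlieBracket_add_right (I := 𝓘(ℝ, E)) (V := Z) hX hX'
  simp only [symKoszul, dirDeriv, h1, h2,
    mvfderiv_add (mdifferentiableAt_pair hX hZ) (mdifferentiableAt_pair hX' hZ),
    mvfderiv_add (mdifferentiableAt_pair hX hY) (mdifferentiableAt_pair hX' hY)]
  simp only [pair, h3, Pi.add_apply, map_add, add_apply]
  ring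

/-- The Leibniz rule `{f x, y} = f {x, y} + y(f) x`. -/
lemma braces_smul_left {f : M → ℝ} (hf : MDifferentiableAt 𝓘(ℝ, E) 𝓘(ℝ) f p)
    (hX : DiffFieldAt X p) (hY : DiffFieldAt Y p) :
    g.braces (f • X) Y p = f p • g.braces X Y p + dirDeriv Y f p • X p := by
  have : CompleteSpace E := FiniteDimensional.complete ℝ E
  refine (eq_braces (hf.smul_section hX) hY _ fun Z hZ ↦ ?_).symm
  rw [map_add, add_apply, map_smul, map_smul, smul_apply, smul_apply, form_braces hX hY hZ]
  have h1 : g.pair (f • X) Z = f * g.pair X Z := by ext q; simp [pair]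
  have h2 : g.pair (f • X) Y = f * g.pair X Y := by ext q; simp [pair]
  have h3 := VectorField.mlieBracket_smul_right (I := 𝓘(ℝ, E)) (V := Z) hf hX
  simp only [symKoszul, dirDeriv, h1, h2, mvfderiv_mul hf (mdifferentiableAt_pair hX hZ),
    mvfderiv_mul hf (mdifferentiableAt_pair hX hY)]
  simp only [pair, h3, Pi.smul_apply', map_add, map_smul, add_apply, smul_apply, smul_eq_mul,
    g.symm p (X p)]
  ring

lemma braces_add_right (hX : DiffFieldAt X p) (hX' : DiffFieldAt X' p) (hY : DiffFieldAt Y p) :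
    g.braces Y (X + X') p = g.braces Y X p + g.braces Y X' p := by
  rw [braces_comm hY (mdifferentiableAt_add_section hX hX'), braces_add_left hX hX' hY,
    braces_comm hX hY, braces_comm hX' hY]

lemma braces_smul_right {f : M → ℝ} (hf : MDifferentiableAt 𝓘(ℝ, E) 𝓘(ℝ) f p)
    (hX : DiffFieldAt X p) (hY : DiffFieldAt Y p) :
    g.braces Y (f • X) p = f p • g.braces Y X p + dirDeriv Y f p • X p := by
  rw [braces_comm hY (hf.smul_section hX), braces_smul_left hf hX hY, braces_comm hX hY]

lemma braces_const_smul_left (c : ℝ) (hX : DiffFieldAt X p) (hY : DiffFieldAt Y p) :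
    g.braces (c • X) Y p = c • g.braces X Y p := by
  have h := braces_smul_left (g := g) (f := fun _ ↦ c) mdifferentiableAt_const hX hY
  rw [show (fun _ : M ↦ c) • X = c • X from rfl] at h
  simpa [dirDeriv, mvfderiv_const] using h

lemma braces_const_smul_right (c : ℝ) (hX : DiffFieldAt X p) (hY : DiffFieldAt Y p) :
    g.braces Y (c • X) p = c • g.braces Y X p := by
  have h := braces_smul_right (g := g) (f := fun _ ↦ c) mdifferentiableAt_const hX hY
  rw [show (fun _ : M ↦ c) • X = c • X from rfl] at h
  simpa [dirDeriv, mvfderiv_const] using h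

lemma braces_sub_smul_left {f : M → ℝ} (hf : MDifferentiableAt 𝓘(ℝ, E) 𝓘(ℝ) f p)
    (hX : DiffFieldAt X p) (hX' : DiffFieldAt X' p) (hY : DiffFieldAt Y p) :
    g.braces (X - f • X') Y p =
      g.braces X Y p - f p • g.braces X' Y p - dirDeriv Y f p • X' p := by
  have hX'' : DiffFieldAt ((-1 : ℝ) • X') p := MDifferentiableAt.smul_const_section hX'
  rw [show X - f • X' = X + f • ((-1 : ℝ) • X') by ext q; simp [sub_eq_add_neg],
    braces_add_left hX (hf.smul_section hX'') hY, braces_smul_left hf hX'' hY,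
    braces_const_smul_left _ hX' hY]
  simp only [Pi.smul_apply]
  module

lemma braces_sub_smul_right {f : M → ℝ} (hf : MDifferentiableAt 𝓘(ℝ, E) 𝓘(ℝ) f p)
    (hX : DiffFieldAt X p) (hX' : DiffFieldAt X' p) (hY : DiffFieldAt Y p) :
    g.braces Y (X - f • X') p =
      g.braces Y X p - f p • g.braces Y X' p - dirDeriv Y f p • X' p := by
  rw [braces_comm hY (mdifferentiableAt_sub_section hX (hf.smul_section hX')),
    braces_sub_smul_left hf hX hX' hY, braces_comm hX hY, braces_comm hX' hY]

lemma braces_zero_left (hY : DiffFieldAt Y p) : g.braces 0 Y p = 0 := by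
  have h := braces_const_smul_left (g := g) 0 hY hY
  rwa [zero_smul, zero_smul] at h

lemma braces_zero_right (hY : DiffFieldAt Y p) : g.braces Y 0 p = 0 := by
  have h := braces_const_smul_right (g := g) 0 hY hY
  rwa [zero_smul, zero_smul] at h

/-- In Levi-Civita terms, `g(∇_x z, y) + g(x, ∇_y z)` with the derivatives moved off `z`. It trades
the Lie derivative for braces. -/
lemma lieDeriv_eq (hX : DiffFieldAt X p) (hY : DiffFieldAt Y p) (hZ : DiffFieldAt Z p) :
    g.lieDeriv Z X Y p =
      dirDeriv X (g.pair Y Z) p + dirDeriv Y (g.pair X Z) p - g.form p (g.braces X Y p) (Z p) := by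
  have h : g.pair (VectorField.mlieBracket 𝓘(ℝ, E) Y Z) X p =
      -g.pair X (VectorField.mlieBracket 𝓘(ℝ, E) Z Y) p := by
    simp [pair, VectorField.mlieBracket_swap_apply (V := Y), g.symm p (X p)]
  rw [form_braces hX hY hZ, symKoszul, lieDeriv, h]
  ring

end PseudoRiemannianMetric

/-! ### Pointwise identities of a single structure. -/

namespace AlmostContactHNMetric3Structure

variable {E : Type*} [NormedAddCommGroup E] [NormedSpace ℝ E]
  {M : Type*} [TopologicalSpace M] [ChartedSpace E M] [IsManifold 𝓘(ℝ, E) ∞ M]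
  {S : AlmostContactHNMetric3Structure E M} {α : Fin 3}
  {X Y : Π p : M, TangentSpace 𝓘(ℝ, E) p}

variable (S) in
/-- The function `η_α(x)`. -/
def eta (α : Fin 3) (X : Π p : M, TangentSpace 𝓘(ℝ, E) p) (p : M) : ℝ := S.η α p (X p)

variable (S) in
lemma smoothField_phi (α : Fin 3) (hX : SmoothField X) : SmoothField (S.phi α X) :=
  ContMDiff.clm_bundle_apply (F₁ := E) (F₂ := E) (S.contMDiff_φ α) hX

variable (S) in
lemma contMDiff_eta (α : Fin 3) (hX : SmoothField X) :
    ContMDiff 𝓘(ℝ, E) 𝓘(ℝ) ∞ (S.eta α X) := by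
  have h : ContMDiff 𝓘(ℝ, E) (𝓘(ℝ, E).prod 𝓘(ℝ)) ∞
      (fun m ↦ Bundle.TotalSpace.mk' ℝ (E := Bundle.Trivial M ℝ) m (S.η α m (X m))) :=
    ContMDiff.clm_bundle_apply (F₁ := E) (F₂ := ℝ) (S.contMDiff_η α) hX
  intro p
  have hp := h p
  simp only [Bundle.contMDiffAt_totalSpace] at hp
  exact hp.2

lemma _root_.HNContact.SmoothField.diffFieldAt (hX : SmoothField X) (p : M) : DiffFieldAt X p :=
  hX.mdifferentiableAt (by simp)

variable (S) in
lemma mdifferentiableAt_eta (α : Fin 3) (hX : SmoothField X) (p : M) :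
    MDifferentiableAt 𝓘(ℝ, E) 𝓘(ℝ) (S.eta α X) p :=
  (contMDiff_eta S α hX).mdifferentiableAt (by simp)

@[simp] lemma φ_ξ_self (α : Fin 3) (p : M) : S.φ α p (S.ξ α p) = 0 := by
  rw [S.φ_ξ]
  fin_cases α <;> simp [leviCivita]

@[simp] lemma η_ξ_self (α : Fin 3) (p : M) : S.η α p (S.ξ α p) = 1 := by
  simp [S.η_ξ]

@[simp] lemma η_φ_self (α : Fin 3) (p : M) (v : TangentSpace 𝓘(ℝ, E) p) :
    S.η α p (S.φ α p v) = 0 := by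
  rw [S.η_φ]
  fin_cases α <;> simp [leviCivita]

@[simp] lemma φ_φ_self (α : Fin 3) (p : M) (v : TangentSpace 𝓘(ℝ, E) p) :
    S.φ α p (S.φ α p v) = -v + S.η α p v • S.ξ α p := by
  rw [S.φ_φ]
  fin_cases α <;> simp [leviCivita]

lemma hnSign_mul_self (α : Fin 3) : hnSign α * hnSign α = 1 := by
  fin_cases α <;> simp [hnSign]

/-- Compatibility with second argument `ξ_α`, where `φ_α ξ_α = 0` makes the left side vanish; then
`ε_α² = 1`. -/
lemma g_ξ (α : Fin 3) (p : M) (v : TangentSpace 𝓘(ℝ, E) p) :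
    S.g.form p v (S.ξ α p) = -hnSign α * S.η α p v := by
  have h := S.g_φ_φ α p v (S.ξ α p)
  rw [φ_ξ_self, map_zero, η_ξ_self] at h
  linear_combination hnSign α * (-h) - S.g.form p v (S.ξ α p) * hnSign_mul_self α

lemma pair_ξ (α : Fin 3) (X : Π p : M, TangentSpace 𝓘(ℝ, E) p) :
    S.g.pair X (S.ξ α) = (fun _ ↦ -hnSign α) * S.eta α X :=
  funext fun p ↦ g_ξ α p (X p)

variable (S) in
/-- `x η_α(y) + y η_α(x) - η_α({x, y})`, that is, `(∇_x η_α) y + (∇_y η_α) x`. -/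
def symDerivEta (α : Fin 3) (X Y : Π p : M, TangentSpace 𝓘(ℝ, E) p) (p : M) : ℝ :=
  dirDeriv X (S.eta α Y) p + dirDeriv Y (S.eta α X) p - S.η α p (S.g.braces X Y p)

lemma phiBraces_apply (X Y : Π p : M, TangentSpace 𝓘(ℝ, E) p) (p : M) :
    S.phiBraces α X Y p = S.g.braces (S.phi α X) (S.phi α Y) p
      + S.φ α p (S.φ α p (S.g.braces X Y p)) - S.φ α p (S.g.braces (S.phi α X) Y p)
      - S.φ α p (S.g.braces X (S.phi α Y) p) := rfl

lemma phi_phi (α : Fin 3) (X : Π p : M, TangentSpace 𝓘(ℝ, E) p) :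
    S.phi α (S.phi α X) = S.eta α X • S.ξ α - X :=
  funext fun p ↦ (φ_φ_self α p (X p)).trans (neg_add_eq_sub _ _)

lemma phi_ξ (α : Fin 3) : S.phi α (S.ξ α) = 0 := funext fun p ↦ φ_ξ_self α p

lemma eta_phi (α : Fin 3) (X : Π p : M, TangentSpace 𝓘(ℝ, E) p) : S.eta α (S.phi α X) = 0 :=
  funext fun p ↦ η_φ_self α p (X p)

lemma eta_ξ (α : Fin 3) : S.eta α (S.ξ α) = fun _ ↦ 1 := funext fun p ↦ η_ξ_self α p

/-! ### The quaternionic triple on `M × ℝ`. -/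

variable (E M) in
/-- The smooth vector fields `x + f ∂/∂t` on `M × ℝ` with `x` and `f` independent of `t`. -/
abbrev ExtField : Type _ :=
  ContMDiffSection 𝓘(ℝ, E) E ∞ (TangentSpace 𝓘(ℝ, E) : M → Type _) ×
    ContMDiffMap 𝓘(ℝ, E) 𝓘(ℝ) M ℝ ∞

lemma smoothField_coe (X : ContMDiffSection 𝓘(ℝ, E) E ∞ (TangentSpace 𝓘(ℝ, E) : M → Type _)) :
    SmoothField (fun p ↦ X p) := X.contMDiff

lemma diffFieldAt_coe (X : ContMDiffSection 𝓘(ℝ, E) E ∞ (TangentSpace 𝓘(ℝ, E) : M → Type _))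
    (p : M) : DiffFieldAt (fun p ↦ X p) p := (smoothField_coe X).diffFieldAt p

variable (S) in
/-- The almost complex structure `x + f ∂/∂t ↦ φ_α x - f ξ_α + η_α(x) ∂/∂t` on vector fields. -/
def extJ (α : Fin 3) : ExtField E M →ₗ[ℝ] ExtField E M where
  toFun x :=
    (⟨S.phi α x.1 - (x.2 : M → ℝ) • S.ξ α,
      (smoothField_phi S α (smoothField_coe x.1)).sub_section
        (x.2.contMDiff.smul_section (S.smooth_ξ α))⟩,
     ⟨S.eta α x.1, contMDiff_eta S α (smoothField_coe x.1)⟩)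
  map_add' x y := by
    ext p
    · simp [phi, add_smul]; abel
    · exact map_add (S.η α p) (x.1 p) (y.1 p)
  map_smul' c x := by
    ext p
    · simp [phi, smul_sub]
    · exact map_smul (S.η α p) c (x.1 p)

variable (S) in
/-- The almost complex structure `extJ` at a point. -/
def extJAt (α : Fin 3) (p : M) :
    TangentSpace 𝓘(ℝ, E) p × ℝ →ₗ[ℝ] TangentSpace 𝓘(ℝ, E) p × ℝ where
  toFun v := (S.φ α p v.1 - v.2 • S.ξ α p, S.η α p v.1)
  map_add' v w := by
    ext
    · simp [add_smul]; abel
    · simp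
  map_smul' c v := by
    ext
    · simp [mul_smul, smul_sub]
    · simp

lemma extJAt_extJAt_self (α : Fin 3) (p : M) (v : TangentSpace 𝓘(ℝ, E) p × ℝ) :
    S.extJAt α p (S.extJAt α p v) = -v := by
  ext
  · simp [extJAt]
  · simp [extJAt]

/-- The term `η_β(v) ξ_α` in `φ_α φ_β v` is cancelled by the `-f ξ_α` part of `J_α`, since `J_β`
puts `η_β(v)` in the `ℝ`-slot. Cyclic order makes the Levi-Civita sign `+1`. -/
lemma extJAt_mul {β γ : Fin 3} (hβ : β = α + 1) (hγ : γ = α + 2) (p : M)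
    (v : TangentSpace 𝓘(ℝ, E) p × ℝ) :
    S.extJAt α p (S.extJAt β p v) = S.extJAt γ p v ∧
      S.extJAt β p (S.extJAt α p v) = -S.extJAt γ p v := by
  suffices h : S.φ α p (S.φ β p v.1) = S.η β p v.1 • S.ξ α p + S.φ γ p v.1 ∧
      S.φ β p (S.φ α p v.1) = S.η α p v.1 • S.ξ β p - S.φ γ p v.1 ∧
      S.φ α p (S.ξ β p) = S.ξ γ p ∧ S.φ β p (S.ξ α p) = -S.ξ γ p ∧
      S.η α p (S.φ β p v.1) = S.η γ p v.1 ∧ S.η β p (S.φ α p v.1) = -S.η γ p v.1 ∧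
      S.η α p (S.ξ β p) = 0 ∧ S.η β p (S.ξ α p) = 0 by
    obtain ⟨h1, h2, h3, h4, h5, h6, h7, h8⟩ := h
    refine ⟨Prod.ext ?_ ?_, Prod.ext ?_ ?_⟩ <;>
      simp only [extJAt, LinearMap.coe_mk, AddHom.coe_mk, map_sub, map_smul, h1, h2, h3, h4, h5,
        h6, h7, h8, Prod.fst_neg, Prod.snd_neg]
    · module
    · simp
    · module
    · simp
  have key : (α = 0 ∧ β = 1 ∧ γ = 2) ∨ (α = 1 ∧ β = 2 ∧ γ = 0) ∨ (α = 2 ∧ β = 0 ∧ γ = 1) := by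
    revert α β γ
    decide
  rw [S.φ_φ, S.φ_φ, S.φ_ξ, S.φ_ξ, S.η_φ, S.η_φ, S.η_ξ, S.η_ξ]
  obtain ⟨rfl, rfl, rfl⟩ | ⟨rfl, rfl, rfl⟩ | ⟨rfl, rfl, rfl⟩ := key <;>
    simp [leviCivita, Fin.sum_univ_three, sub_eq_add_neg]

lemma extJ_apply (α : Fin 3) (x : ExtField E M) (p : M) :
    ((S.extJ α x).1 p, (S.extJ α x).2 p) = S.extJAt α p (x.1 p, x.2 p) := rfl

lemma extField_ext {x y : ExtField E M} (h : ∀ p, (x.1 p, x.2 p) = (y.1 p, y.2 p)) : x = y := by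
  ext p
  · exact congrArg Prod.fst (h p)
  · exact congrArg Prod.snd (h p)

/-! ### Consequences of the vanishing of one associated tensor. -/

variable [FiniteDimensional ℝ E]

open PseudoRiemannianMetric

lemma symDerivEta_eq {p : M} (hX : SmoothField X) (hY : SmoothField Y) :
    S.symDerivEta α X Y p = -(hnSign α * S.g.lieDeriv (S.ξ α) X Y p) := by
  rw [PseudoRiemannianMetric.lieDeriv_eq (hX.diffFieldAt p) (hY.diffFieldAt p)
    ((S.smooth_ξ α).diffFieldAt p), pair_ξ, pair_ξ, g_ξ]
  simp only [dirDeriv, mvfderiv_mul mdifferentiableAt_const (mdifferentiableAt_eta S α hX p),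
    mvfderiv_mul mdifferentiableAt_const (mdifferentiableAt_eta S α hY p), mvfderiv_const]
  simp only [symDerivEta, dirDeriv, smul_zero, add_zero, smul_apply, smul_eq_mul]
  linear_combination (-(mvfderiv 𝓘(ℝ, E) (S.eta α Y) p (X p)
    + mvfderiv 𝓘(ℝ, E) (S.eta α X) p (Y p) - S.η α p (S.g.braces X Y p))) * hnSign_mul_self α

/-- This form of the tensor is free of `ε_α`: the metric enters only through the braces. -/
lemma assocNijenhuis_eq {p : M} (hX : SmoothField X) (hY : SmoothField Y) :
    S.assocNijenhuis α X Y p =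
      S.phiBraces α X Y p + S.symDerivEta α X Y p • S.ξ α p := by
  rw [assocNijenhuis, symDerivEta_eq hX hY, neg_smul, sub_eq_add_neg]

/-- Expanding `φ_α²` produces `η_α({x, y}) ξ_α`, which cancels the same term in `symDerivEta`. -/
lemma AssocNijenhuisVanishes.phiBraces_eq (H : S.AssocNijenhuisVanishes α)
    (hX : SmoothField X) (hY : SmoothField Y) (p : M) :
    S.g.braces (S.phi α X) (S.phi α Y) p - S.g.braces X Y p
      - S.φ α p (S.g.braces (S.phi α X) Y p) - S.φ α p (S.g.braces X (S.phi α Y) p)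
      + (dirDeriv X (S.eta α Y) p + dirDeriv Y (S.eta α X) p) • S.ξ α p = 0 := by
  have h := H X Y hX hY p
  rw [assocNijenhuis_eq hX hY, phiBraces_apply, φ_φ_self, symDerivEta] at h
  linear_combination (norm := module) h

lemma AssocNijenhuisVanishes.braces_ξ (H : S.AssocNijenhuisVanishes α)
    (hX : SmoothField X) (p : M) :
    S.g.braces (S.phi α X) (S.ξ α) p = S.φ α p (S.g.braces X (S.ξ α) p)
      ∧ S.η α p (S.g.braces X (S.ξ α) p) = dirDeriv (S.ξ α) (S.eta α X) p := by
  -- The case of second argument `ξ_α`, where `φ_α ξ_α = 0` and `η_α(ξ_α)` is constant. Applying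
  -- `η_α` gives the second claim; applying `φ_α`, with the second claim for `φ_α x`, gives the
  -- first.
  have key {Y : Π p : M, TangentSpace 𝓘(ℝ, E) p} (hY : SmoothField Y) :
      - S.g.braces Y (S.ξ α) p - S.φ α p (S.g.braces (S.phi α Y) (S.ξ α) p)
        + dirDeriv (S.ξ α) (S.eta α Y) p • S.ξ α p = 0 := by
    have h := H.phiBraces_eq hY (S.smooth_ξ α) p
    rw [phi_ξ, braces_zero_right ((smoothField_phi S α hY).diffFieldAt p),
      braces_zero_right (hY.diffFieldAt p), eta_ξ,
      dirDeriv_const, map_zero] at h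
    linear_combination (norm := module) h
  have key' {Y : Π p : M, TangentSpace 𝓘(ℝ, E) p} (hY : SmoothField Y) :
      S.η α p (S.g.braces Y (S.ξ α) p) = dirDeriv (S.ξ α) (S.eta α Y) p := by
    have h := congrArg (S.η α p) (key hY)
    simp only [map_add, map_sub, map_neg, map_smul, η_φ_self, η_ξ_self, map_zero,
      smul_eq_mul] at h
    linear_combination -h
  refine ⟨?_, key' hX⟩
  have h := congrArg (S.φ α p) (key hX)
  have h' := key' (smoothField_phi S α hX)
  rw [eta_phi, dirDeriv_zero] at h'
  simp only [map_add, map_sub, map_neg, map_smul, φ_ξ_self, φ_φ_self, map_zero, h'] at h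
  linear_combination (norm := module) h

lemma AssocNijenhuisVanishes.braces_ξ_ξ (H : S.AssocNijenhuisVanishes α) (p : M) :
    S.g.braces (S.ξ α) (S.ξ α) p = 0 := by
  have h := H.phiBraces_eq (S.smooth_ξ α) (S.smooth_ξ α) p
  have hξ := (S.smooth_ξ α).diffFieldAt p
  have hz := (smoothField_phi S α (S.smooth_ξ α)).diffFieldAt p
  rw [phi_ξ] at hz
  rw [phi_ξ, braces_zero_left hz, braces_zero_left hξ, braces_zero_right hξ, eta_ξ,
    dirDeriv_const, map_zero] at h
  linear_combination (norm := module) -h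

/-- Obtained by applying `η_α` to `phiBraces_eq` at `(φ_α x, y)`. The Leibniz rule for `φ_α² x =
η_α(x) ξ_α - x` yields the derivative along `φ_α y`, and `η_α({ξ_α, φ_α y}) = 0`. -/
lemma AssocNijenhuisVanishes.dirDeriv_phi (H : S.AssocNijenhuisVanishes α)
    (hX : SmoothField X) (hY : SmoothField Y) (p : M) :
    dirDeriv (S.phi α X) (S.eta α Y) p + dirDeriv (S.phi α Y) (S.eta α X) p
      = S.η α p (S.g.braces (S.phi α X) Y p) + S.η α p (S.g.braces X (S.phi α Y) p) := by
  have hφY := smoothField_phi S α hY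
  have h := congrArg (S.η α p) (H.phiBraces_eq (smoothField_phi S α hX) hY p)
  have h' := (H.braces_ξ hφY p).2
  rw [braces_comm (hφY.diffFieldAt p) ((S.smooth_ξ α).diffFieldAt p), eta_phi,
    dirDeriv_zero] at h'
  have hsub : S.eta α X • S.ξ α - X = (-1 : ℝ) • (X - S.eta α X • S.ξ α) := by simp
  have hηX := mdifferentiableAt_eta S α hX p
  rw [phi_phi, hsub, braces_const_smul_left _ (mdifferentiableAt_sub_section (hX.diffFieldAt p)
    (hηX.smul_section ((S.smooth_ξ α).diffFieldAt p))) (hφY.diffFieldAt p),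
    braces_sub_smul_left hηX (hX.diffFieldAt p) ((S.smooth_ξ α).diffFieldAt p)
      (hφY.diffFieldAt p), eta_phi, dirDeriv_zero] at h
  simp only [map_add, map_sub, map_smul, η_φ_self, η_ξ_self, map_zero, smul_eq_mul, h'] at h
  linear_combination h

/-! ### Transfer between `M` and `M × ℝ`. -/

/-- The symmetric braces on `M × ℝ` for the product metric, at a point. -/
def extBraces (g : PseudoRiemannianMetric E M) (p : M) :
    ExtField E M →ₗ[ℝ] ExtField E M →ₗ[ℝ] TangentSpace 𝓘(ℝ, E) p × ℝ :=
  LinearMap.mk₂ ℝ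
    (fun x y ↦ (g.braces x.1 y.1 p, dirDeriv x.1 y.2 p + dirDeriv y.1 x.2 p))
    (fun x x' y ↦ by
      ext
      · exact braces_add_left (diffFieldAt_coe x.1 p) (diffFieldAt_coe x'.1 p)
          (diffFieldAt_coe y.1 p)
      · simp [dirDeriv, mvfderiv_add (x.2.contMDiff.mdifferentiableAt (by simp))
          (x'.2.contMDiff.mdifferentiableAt (by simp))]
        ring)
    (fun c x y ↦ by
      ext
      · exact braces_const_smul_left c (diffFieldAt_coe x.1 p) (diffFieldAt_coe y.1 p)
      · exact (congrArg₂ (· + ·) (dirDeriv_const_smul_left c x.1 y.2 p)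
          (dirDeriv_const_smul c y.1 (x.2.contMDiff.mdifferentiableAt (by simp)))).trans
            (mul_add _ _ _).symm)
    (fun x y y' ↦ by
      ext
      · exact braces_add_right (diffFieldAt_coe y.1 p) (diffFieldAt_coe y'.1 p)
          (diffFieldAt_coe x.1 p)
      · simp [dirDeriv, mvfderiv_add (y.2.contMDiff.mdifferentiableAt (by simp))
          (y'.2.contMDiff.mdifferentiableAt (by simp))]
        ring)
    (fun c x y ↦ by
      ext
      · exact braces_const_smul_right c (diffFieldAt_coe y.1 p) (diffFieldAt_coe x.1 p)
      · exact (congrArg₂ (· + ·) (dirDeriv_const_smul c x.1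
          (y.2.contMDiff.mdifferentiableAt (by simp))) (dirDeriv_const_smul_left c y.1 x.2 p)).trans
            (mul_add _ _ _).symm)

theorem nijenhuis_extJ_eq_zero (H : S.AssocNijenhuisVanishes α) (p : M) (x y : ExtField E M) :
    nijenhuis (extBraces S.g p) (S.extJ α) (S.extJAt α p) x y = 0 := by
  obtain ⟨X, f⟩ := x
  obtain ⟨Y, h⟩ := y
  have hX := smoothField_coe X
  have hY := smoothField_coe Y
  have hf : MDifferentiableAt 𝓘(ℝ, E) 𝓘(ℝ) f p := f.contMDiff.mdifferentiableAt (by simp)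
  have hh : MDifferentiableAt 𝓘(ℝ, E) 𝓘(ℝ) h p := h.contMDiff.mdifferentiableAt (by simp)
  have hξ := (S.smooth_ξ α).diffFieldAt p
  have hφX := (smoothField_phi S α hX).diffFieldAt p
  have hφY := (smoothField_phi S α hY).diffFieldAt p
  have hX' := hX.diffFieldAt p
  have hY' := hY.diffFieldAt p
  have hφYh : DiffFieldAt (S.phi α Y - (h : M → ℝ) • S.ξ α) p :=
    mdifferentiableAt_sub_section hφY (hh.smul_section hξ)
  have h1 := H.phiBraces_eq hX hY p
  have h2 := H.dirDeriv_phi hX hY p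
  obtain ⟨h3, h4⟩ := H.braces_ξ hX p
  obtain ⟨h5, h6⟩ := H.braces_ξ hY p
  have h7 := H.braces_ξ_ξ p
  have h8 := braces_comm (g := S.g) hξ hY'
  have h9 := braces_comm (g := S.g) hξ hφY
  ext
  -- The `M`-component. The Leibniz terms from the first brace cancel the `ξ_α`-terms of `J_α`;
  -- those inside `φ_α` die because `φ_α ξ_α = 0`.
  · change S.g.braces (S.phi α X - (f : M → ℝ) • S.ξ α) (S.phi α Y - (h : M → ℝ) • S.ξ α) p
      - S.g.braces X Y p
      - (S.φ α p (S.g.braces (S.phi α X - (f : M → ℝ) • S.ξ α) Y p)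
        - (dirDeriv (S.phi α X - (f : M → ℝ) • S.ξ α) h p + dirDeriv Y (S.eta α X) p) • S.ξ α p)
      - (S.φ α p (S.g.braces X (S.phi α Y - (h : M → ℝ) • S.ξ α) p)
        - (dirDeriv X (S.eta α Y) p + dirDeriv (S.phi α Y - (h : M → ℝ) • S.ξ α) f p)
          • S.ξ α p) = 0
    rw [braces_sub_smul_left hf hφX hξ hφYh, braces_sub_smul_right hh hφY hξ hφX,
      braces_sub_smul_right hh hφY hξ hξ, braces_sub_smul_left hf hφX hξ hY',
      braces_sub_smul_right hh hφY hξ hX', h9, h8, h3, h5, h7]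
    simp only [dirDeriv_sub_smul_left, map_sub, map_smul, φ_ξ_self]
    linear_combination (norm := module) h1
  -- The `ℝ`-component. Here `X(h)` and `Y(f)` cancel against the Leibniz terms, since `η_α(ξ_α) =
  -- 1`.
  · change dirDeriv (S.phi α X - (f : M → ℝ) • S.ξ α) (S.eta α Y) p
      + dirDeriv (S.phi α Y - (h : M → ℝ) • S.ξ α) (S.eta α X) p
      - (dirDeriv X h p + dirDeriv Y f p)
      - S.η α p (S.g.braces (S.phi α X - (f : M → ℝ) • S.ξ α) Y p)
      - S.η α p (S.g.braces X (S.phi α Y - (h : M → ℝ) • S.ξ α) p) = 0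
    rw [braces_sub_smul_left hf hφX hξ hY', braces_sub_smul_right hh hφY hξ hX', h8]
    simp only [dirDeriv_sub_smul_left, map_sub, map_smul, η_ξ_self, smul_eq_mul, h4, h6]
    linear_combination h2

theorem assocNijenhuisVanishes_of_nijenhuis
    (H : ∀ (p : M) (x y : ExtField E M),
      nijenhuis (extBraces S.g p) (S.extJ α) (S.extJAt α p) x y = 0) :
    S.AssocNijenhuisVanishes α := by
  intro X Y hX hY p
  -- The zero multiples of `ξ_α` are kept so that this is the first component of the concomitant by
  -- definition.
  have h : S.g.braces (S.phi α X - (0 : M → ℝ) • S.ξ α) (S.phi α Y - (0 : M → ℝ) • S.ξ α) p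
      - S.g.braces X Y p
      - (S.φ α p (S.g.braces (S.phi α X - (0 : M → ℝ) • S.ξ α) Y p)
        - (dirDeriv (S.phi α X - (0 : M → ℝ) • S.ξ α) 0 p + dirDeriv Y (S.eta α X) p) • S.ξ α p)
      - (S.φ α p (S.g.braces X (S.phi α Y - (0 : M → ℝ) • S.ξ α) p)
        - (dirDeriv X (S.eta α Y) p + dirDeriv (S.phi α Y - (0 : M → ℝ) • S.ξ α) 0 p)
          • S.ξ α p) = 0 :=
    congrArg Prod.fst (H p (⟨X, hX⟩, 0) (⟨Y, hY⟩, 0))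
  have h0 (Z : Π p : M, TangentSpace 𝓘(ℝ, E) p) : Z - (0 : M → ℝ) • S.ξ α = Z := by
    rw [zero_smul, sub_zero]
  simp only [h0, dirDeriv_zero] at h
  rw [assocNijenhuis_eq hX hY, phiBraces_apply, φ_φ_self, symDerivEta]
  linear_combination (norm := module) h

theorem AssocNijenhuisVanishes.of_cyclic {β γ : Fin 3} (hαβ : β = α + 1)
    (hαγ : γ = α + 2) (hα : S.AssocNijenhuisVanishes α) (hβ : S.AssocNijenhuisVanishes β) :
    S.AssocNijenhuisVanishes γ := by
  refine assocNijenhuisVanishes_of_nijenhuis fun p ↦ nijenhuis_mul_eq_zero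
    (fun x ↦ extField_ext fun q ↦ ?_) (fun x ↦ extField_ext fun q ↦ ?_)
    (fun x ↦ extField_ext fun q ↦ ?_) (fun x ↦ extField_ext fun q ↦ ?_)
    (extJAt_extJAt_self α p) (extJAt_extJAt_self β p)
    (fun v ↦ (extJAt_mul hαβ hαγ p v).1) (fun v ↦ (extJAt_mul hαβ hαγ p v).2)
    (nijenhuis_extJ_eq_zero hα p) (nijenhuis_extJ_eq_zero hβ p)
  · rw [extJ_apply, extJ_apply, extJAt_extJAt_self]
    rfl
  · rw [extJ_apply, extJ_apply, extJAt_extJAt_self]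
    rfl
  · rw [extJ_apply, extJ_apply, extJ_apply, (extJAt_mul hαβ hαγ q _).1]
  · rw [extJ_apply, extJ_apply, (extJAt_mul hαβ hαγ q _).2]
    rfl

end AlmostContactHNMetric3Structure

end HNContact

end

theorem theorem7 (n : ℕ) {M : Type*} [TopologicalSpace M] [T2Space M]
    [ChartedSpace (EuclideanSpace ℝ (Fin (4 * n + 3))) M]
    [IsManifold (𝓡 (4 * n + 3)) ∞ M]
    (S : HNContact.AlmostContactHNMetric3Structure (EuclideanSpace ℝ (Fin (4 * n + 3))) M)
    (α β γ : Fin 3) (hαβ : α ≠ β) (hαγ : α ≠ γ) (hβγ : β ≠ γ)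
    (hα : S.AssocNijenhuisVanishes α) (hβ : S.AssocNijenhuisVanishes β) :
    S.AssocNijenhuisVanishes γ := by
  -- Of two distinct indices modulo 3, one is the cyclic successor of the other; exchanging `α` and
  -- `β` covers the second case.
  have h : (β = α + 1 ∧ γ = α + 2) ∨ (α = β + 1 ∧ γ = β + 2) := by
    clear hα hβ
    revert α β γ
    decide
  obtain ⟨h, h'⟩ | ⟨h, h'⟩ := h
  · exact .of_cyclic h h' hα hβ
  · exact .of_cyclic h h' hβ hα
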